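/- Let $n,m\ge 1$ be integers. Graphs are finite and may have parallel edges but no loops; a perfect matching of a graph is a set of edges such that every vertex is incident with exactly one edge of the set, and $M(G)$ is the number of perfect matchings of $G$ (parallel edges are distinct). Let $G(n,m)$ be the following parallelogram of the Kagomé lattice: its vertices are the points $(x,y)\in\mathbb Z^2$ with $0\le x\le 2n$, $0\le y\le 4m$ and $x,y$ not both even, two of them being adjacent if and only if they differ by $\pm(1,0)$, $\pm(0,1)$ or $\pm(1,-1)$. For $1\le i\le 2m$ and $1\le j\le n$ put $u_i=(0,2i-1)$, $u_i^*=(2n,2i-1)$, $v_j=(2j-1,0)$, $v_j^*=(2j-1,4m)$. The Kagomé lattices with toroidal, cylindrical and free boundary conditions are the following graphs. - $K^T(n,m)$ is obtained from $G(n,m)$ by identifying $u_i$ with $u_i^*$ for all $i$ and $v_j$ with $v_j^*$ for all $j$ (all edges are kept, so parallel edges arise when $n=1$). - $K^C(n,m)$ is obtained from $G(n,m)$ by deleting all $v_j^*$ and then identifying $u_i$ with $u_i^*$ for all $i$ (again keeping the remaining edges). - $K^F(n,m)$ is obtained from $G(n,m)$ by deleting all $u_i^*$ and all $v_j^*$.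 Then for all integers $n,m\ge 1$ $$M(K^T(n,m))=2^{2mn+1},\qquad M(K^C(n,m))=2^{2mn-n+1},\qquad M(K^F(n,m))=2^{2mn-2m-n+1}.$$ Moreover, all three families have entropy $\tfrac23\ln 2$: for $K=K^T,K^C,K^F$, $$\lim_{n,m\to\infty}\frac{2\ln M(K(n,m))}{|V(K(n,m))|}=\tfrac23\ln 2 .$$ -/

import Mathlib

open Filter Topology
open scoped Graph

noncomputable section

namespace KagomeDimers

/-- A perfect matching of a multigraph: a set of edges, none of them a loop, such that every
vertex is incident with exactly one edge of the set. -/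
def IsPerfectMatching {α β : Type*} (G : Graph α β) (M : Set β) : Prop :=
  M ⊆ E(G) ∧ (∀ e ∈ M, ∀ x, ¬ G.IsLoopAt e x) ∧ ∀ x ∈ V(G), ∃! e, e ∈ M ∧ G.Inc e x

/-- The number `M(G)` of perfect matchings. These are sets of edges, so that the choice between
parallel edges is counted. -/
def numPerfectMatchings {α β : Type*} (G : Graph α β) : ℕ :=
  {M : Set β | IsPerfectMatching G M}.ncard

/-- The two-parameter family `G n m` has entropy `h`: `2 log M(G n m) / |V(G n m)|` tends to `h`
as `n` and `m` tend to infinity (independently of each other). -/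
def HasEntropy {α β : Type*} (G : ℕ → ℕ → Graph α β) (h : ℝ) : Prop :=
  Tendsto (fun p : ℕ × ℕ =>
      2 * Real.log (numPerfectMatchings (G p.1 p.2)) / ((V(G p.1 p.2)).ncard : ℝ))
    (atTop ×ˢ atTop) (𝓝 h)

/-- The triangular lattice in lattice coordinates: every point of `ℤ × ℤ` is joined to its six
translates by `±(1, 0)`, `±(0, 1)`, `±(1, -1)`. -/
def triangularLattice : SimpleGraph (ℤ × ℤ) :=
  SimpleGraph.fromRel fun p q => q = p + (1, 0) ∨ q = p + (0, 1) ∨ q = p + (1, -1)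

/-- The sites of the Kagomé lattice (the points of the triangular lattice whose coordinates are
not both even) that lie in the parallelogram `[0, 2n] × [0, 4m]`. -/
def patchSites (n m : ℕ) : Set (ℤ × ℤ) :=
  {p | (Odd p.1 ∨ Odd p.2) ∧ (0 ≤ p.1 ∧ p.1 ≤ 2 * n) ∧ (0 ≤ p.2 ∧ p.2 ≤ 4 * m)}

/-- The plane lattice graph `G(n, m)`, a parallelogram of the Kagomé lattice with `n` hexagonal
cells in one direction and `2m` in the other. Its vertices of degree two are
`u i = (0, 2i - 1)` and `u* i = (2n, 2i - 1)` for `1 ≤ i ≤ 2m` on the left and on the right, and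
`v j = (2j - 1, 0)` and `v* j = (2j - 1, 4m)` for `1 ≤ j ≤ n` at the bottom and at the top; all
its other vertices have degree four. -/
def patch (n m : ℕ) : Graph (ℤ × ℤ) (Sym2 (ℤ × ℤ)) :=
  (Graph.ofSimpleGraph triangularLattice).induce (patchSites n m)

/-- The set of the vertices `u* i`, `1 ≤ i ≤ 2m`. -/
def uStars (n m : ℕ) : Set (ℤ × ℤ) :=
  {p | ∃ i : ℕ, 1 ≤ i ∧ i ≤ 2 * m ∧ p = (2 * (n : ℤ), 2 * (i : ℤ) - 1)}

/-- The set of the vertices `v* j`, `1 ≤ j ≤ n`. -/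
def vStars (n m : ℕ) : Set (ℤ × ℤ) :=
  {p | ∃ j : ℕ, 1 ≤ j ∧ j ≤ n ∧ p = (2 * (j : ℤ) - 1, 4 * (m : ℤ))}

/-- The identification of each `u* i = (2n, 2i - 1)` with `u i = (0, 2i - 1)`; every other vertex
of `patch n m` is fixed. -/
def glueU (n : ℕ) (p : ℤ × ℤ) : ℤ × ℤ := if p.1 = 2 * n then (0, p.2) else p

/-- The identification of each `v* j = (2j - 1, 4m)` with `v j = (2j - 1, 0)`; every other vertex
of `patch n m` is fixed. -/
def glueV (m : ℕ) (p : ℤ × ℤ) : ℤ × ℤ := if p.2 = 4 * m then (p.1, 0) else p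

/-- The Kagomé lattice `K^T(n, m)` with toroidal boundary condition. Edges are kept when vertices
are identified, so parallel edges can arise (they do exactly for `n = 1`). -/
def kagomeTorus (n m : ℕ) : Graph (ℤ × ℤ) (Sym2 (ℤ × ℤ)) :=
  ((patch n m).map (glueU n)).map (glueV m)

/-- The Kagomé lattice `K^C(n, m)` with cylindrical boundary condition: delete the `v* j`, and
identify the `u* i` with the `u i`. -/
def kagomeCylinder (n m : ℕ) : Graph (ℤ × ℤ) (Sym2 (ℤ × ℤ)) :=
  ((patch n m).deleteVerts (vStars n m)).map (glueU n)

/-- The Kagomé lattice `K^F(n, m)` with free boundary condition: delete the `u* i` and the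
`v* j`. -/
def kagomeFree (n m : ℕ) : Graph (ℤ × ℤ) (Sym2 (ℤ × ℤ)) :=
  (patch n m).deleteVerts (uStars n m ∪ vStars n m)

end KagomeDimers

end

/-! Every site of the Kagomé torus is a corner of exactly two triangles, one of each type, and every
edge lies in exactly one triangle. A perfect matching therefore assigns to each site the type of the
triangle containing its matching edge. Two edges of a triangle share a corner, so a triangle
contains at most one matching edge and has 0 or 2 corners assigned to it. Conversely, an assignment
giving every triangle an even number of its own corners determines the matching. Evenness is affine
linear over `ZMod 2`, so counting matchings becomes counting the solutions of a linear system
(`ncard_dimerCover`).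

Let `a` and `b` be the values on sites of kinds 0 and 1. The type 1 triangles eliminate kind 2,
leaving `a (i+1, j) + a (i, j) + b (i, j+1) + b (i, j) = 1`. Since the number of rows is even, this
is solvable in `b` exactly when all column sums of `a` agree, and then `b` is fixed by its bottom
row. The free parameters are thus the common column sum, `a` off the bottom row, and `b` on the
bottom row: `1 + n(2m-1) + n` bits (`injOn_param`, `exists_isEven_param_eq`).

Deleting the starred vertices removes no site of the torus; it only forbids the type 0 triangle at
certain sites. For the cylinder this sets `b = 1` on the bottom row. For the free boundary also `a =
1` on the first column, which forces the common column sum to be 0 and leaves `(n-1)(2m-1)` bits. -/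

namespace KagomeDimers

/-! ### Dimer covers of the torus as even assignments -/

variable {k l : ℕ}

/-- The cells of the lattice on a torus, with `k + 1` columns and `l + 1` rows. Every cell contains
three sites, two triangles and six edges. -/
abbrev Cell (k l : ℕ) : Type := Fin (k + 1) × Fin (l + 1)

/-- A site is given by its cell and its kind. -/
abbrev Site (k l : ℕ) : Type := Cell k l × Fin 3

/-- An edge is given by the type of its triangle, by the cell of its triangle and by the kind of
the corner of this triangle that it misses. -/
abbrev TriEdge (k l : ℕ) : Type := ZMod 2 × Cell k l × Fin 3

/-- The cell of the corner of kind `s` of the triangle of type `t` that belongs to the cell `d`. -/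
def corner (t : ZMod 2) (d : Cell k l) (s : Fin 3) : Cell k l :=
  if t = 1 then d else if s = 0 then (d.1 + 1, d.2) else if s = 1 then (d.1, d.2 + 1) else d

/-- Incidence of edges and sites. -/
def TriEdge.Inc (e : TriEdge k l) (v : Site k l) : Prop :=
  v.2 ≠ e.2.2 ∧ corner e.1 e.2.1 v.2 = v.1

/-- A set of edges that covers every site exactly once. -/
def IsDimerCover (M : Set (TriEdge k l)) : Prop :=
  ∀ v, ∃! e, e ∈ M ∧ TriEdge.Inc e v

/-- An assignment of triangle types to the sites for which every triangle contains an even number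
of sites with its own type. -/
def IsEven (x : Site k l → ZMod 2) : Prop :=
  ∀ t d, ∑ s, x (corner t d s, s) = 1 + t

/-- The edges both ends of which are assigned the triangle of the edge. -/
def coverOf (x : Site k l → ZMod 2) : Set (TriEdge k l) :=
  {e | ∀ s, s ≠ e.2.2 → x (corner e.1 e.2.1 s, s) = e.1}

theorem zmod_two_eq (t : ZMod 2) : t = 0 ∨ t = 1 := by decide +revert

theorem corner_injective (t : ZMod 2) (s : Fin 3) :
    Function.Injective fun d : Cell k l => corner t d s := by
  intro d d' h
  simp only [corner] at h
  split_ifs at h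
  · exact h
  · simpa [Prod.ext_iff] using h
  · simpa [Prod.ext_iff] using h
  · exact h

theorem corner_surjective (t : ZMod 2) (s : Fin 3) :
    Function.Surjective fun d : Cell k l => corner t d s :=
  Finite.surjective_of_injective (corner_injective t s)

/-- By parity, a triangle with one corner of its own type has exactly two; the omitted corner is the
third. -/
theorem existsUnique_omitted_corner :
    ∀ (t : ZMod 2) (z : Fin 3 → ZMod 2), ∑ s, z s = 1 + t → ∀ s, z s = t →
      ∃! o, s ≠ o ∧ ∀ r, r ≠ o → z r = t := by
  unfold ExistsUnique
  decide

theorem IsEven.existsUnique_omitted {x : Site k l → ZMod 2} (hx : IsEven x) {t : ZMod 2}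
    {d : Cell k l} {s : Fin 3} (h : x (corner t d s, s) = t) :
    ∃! o, s ≠ o ∧ (t, d, o) ∈ coverOf x :=
  existsUnique_omitted_corner t (fun s => x (corner t d s, s)) (hx t d) s h

theorem IsEven.isDimerCover {x : Site k l → ZMod 2} (hx : IsEven x) :
    IsDimerCover (coverOf x) := by
  rintro ⟨c, s⟩
  obtain ⟨d, hd⟩ := corner_surjective (x (c, s)) s c
  obtain ⟨o, ⟨ho, hm⟩, hu⟩ := hx.existsUnique_omitted (t := x (c, s)) (d := d) (s := s) (by
    rw [show corner (x (c, s)) d s = c from hd])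
  refine ⟨(x (c, s), d, o), ⟨hm, ho, hd⟩, ?_⟩
  rintro ⟨t, d', o'⟩ ⟨hm', ho', hd'⟩
  have ht : t = x (c, s) := by
    have := hm' s ho'
    simp only [show corner t d' s = c from hd'] at this
    exact this.symm
  subst ht
  obtain rfl : d' = d := corner_injective _ _ (hd'.trans hd.symm)
  rw [hu o' ⟨ho', hm'⟩]

/-- A cover contains an edge of the triangle `(t, d)` that is incident with the corner `s`. -/
def CoveredIn (M : Set (TriEdge k l)) (t : ZMod 2) (d : Cell k l) (s : Fin 3) : Prop :=
  ∃ o, s ≠ o ∧ (t, d, o) ∈ M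

/-- This recovers the assignment from its cover, whence the injectivity of `coverOf`. -/
theorem coveredIn_coverOf_iff {x : Site k l → ZMod 2} (hx : IsEven x) {t : ZMod 2}
    {d : Cell k l} {s : Fin 3} : CoveredIn (coverOf x) t d s ↔ x (corner t d s, s) = t :=
  ⟨fun ⟨_, ho, hm⟩ => hm s ho, fun h => (hx.existsUnique_omitted h).exists⟩

theorem injOn_coverOf : Set.InjOn coverOf {x : Site k l → ZMod 2 | IsEven x} := by
  intro x hx y hy h
  ext ⟨c, s⟩
  obtain ⟨d, hd⟩ := corner_surjective (x (c, s)) s c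
  have hd : corner (x (c, s)) d s = c := hd
  have := (coveredIn_coverOf_iff hx (t := x (c, s)) (d := d) (s := s)).2 (by rw [hd])
  rw [h, coveredIn_coverOf_iff hy, hd] at this
  exact this.symm

/-- Any two edges of a triangle share a corner, which would be covered twice. -/
theorem IsDimerCover.omitted_unique {M : Set (TriEdge k l)} (hM : IsDimerCover M) {t : ZMod 2}
    {d : Cell k l} {o o' : Fin 3} (h : (t, d, o) ∈ M) (h' : (t, d, o') ∈ M) : o = o' := by
  obtain ⟨s, hs, hs'⟩ : ∃ s, s ≠ o ∧ s ≠ o' := by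
    have : ∀ o o' : Fin 3, ∃ s, s ≠ o ∧ s ≠ o' := by decide
    exact this o o'
  have := (hM (corner t d s, s)).unique ⟨h, hs, rfl⟩ ⟨h', hs', rfl⟩
  simpa using this

theorem IsDimerCover.coveredIn_unique {M : Set (TriEdge k l)} (hM : IsDimerCover M)
    {t t' : ZMod 2} {d d' : Cell k l} {s : Fin 3} (hd : corner t d s = corner t' d' s)
    (h : CoveredIn M t d s) (h' : CoveredIn M t' d' s) : t = t' := by
  obtain ⟨o, ho, hm⟩ := h
  obtain ⟨o', ho', hm'⟩ := h'
  have := (hM (corner t d s, s)).unique ⟨hm, ho, rfl⟩ ⟨hm', ho', hd.symm⟩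
  exact congrArg Prod.fst this

theorem sum_eq_of_covered :
    ∀ (t : ZMod 2) (z : Fin 3 → ZMod 2) (o : Fin 3), (∀ s, z s = t ↔ s ≠ o) →
      ∑ s, z s = 1 + t := by
  decide

theorem sum_eq_of_not_covered :
    ∀ (t : ZMod 2) (z : Fin 3 → ZMod 2), (∀ s, z s ≠ t) → ∑ s, z s = 1 + t := by
  decide

/-- The preimage sends each site to the type of the triangle in which it is covered. A triangle
containing an edge of the cover has exactly the two ends of that edge covered in it; any other
triangle has none. -/
theorem surjOn_coverOf :
    Set.SurjOn coverOf {x : Site k l → ZMod 2 | IsEven x} {M | IsDimerCover M} := by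
  intro M hM
  have hM : IsDimerCover M := hM
  have hex : ∀ v : Site k l, ∃ t, ∃ d, corner t d v.2 = v.1 ∧ CoveredIn M t d v.2 := fun v => by
    obtain ⟨⟨t, d, o⟩, ⟨hm, ho, hd⟩, -⟩ := hM v
    exact ⟨t, d, hd, o, ho, hm⟩
  choose x hx using hex
  have key : ∀ t d s, x (corner t d s, s) = t ↔ CoveredIn M t d s := by
    intro t d s
    obtain ⟨d', hd', hc⟩ := hx (corner t d s, s)
    constructor
    · intro h
      rw [h] at hd' hc
      obtain rfl : d' = d := corner_injective t s hd'
      exact hc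
    · exact fun h => hM.coveredIn_unique hd' hc h
  have unique : ∀ {t d o}, (t, d, o) ∈ M → ∀ s, CoveredIn M t d s ↔ s ≠ o := by
    intro t d o hm s
    refine ⟨?_, fun h => ⟨o, h, hm⟩⟩
    rintro ⟨o', ho', hm'⟩
    rwa [hM.omitted_unique hm hm']
  have even : IsEven x := by
    intro t d
    by_cases h : ∃ o, (t, d, o) ∈ M
    · obtain ⟨o, ho⟩ := h
      exact sum_eq_of_covered t _ o fun s => (key t d s).trans (unique ho s)
    · refine sum_eq_of_not_covered t _ fun s hs => h ?_
      obtain ⟨o, -, ho⟩ := (key t d s).1 hs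
      exact ⟨o, ho⟩
  refine ⟨x, even, ?_⟩
  ext ⟨t, d, o⟩
  constructor
  · intro h
    obtain ⟨s, hs⟩ : ∃ s, s ≠ o := exists_ne o
    obtain ⟨o', ho', hm'⟩ := (key t d s).1 (h s hs)
    -- If the triangle's matching edge omitted some `o' ≠ o`, then the corner `o'` would have type
    -- `t`, yet it is not covered in this triangle.
    by_contra hne
    have hoo : o ≠ o' := fun h => hne (h ▸ hm')
    exact (unique hm' o').1 ((key t d o').1 (h o' hoo.symm)) rfl
  · exact fun h s hs => (key t d s).2 ((unique h s).2 hs)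

/-- Covers avoiding some triangle corners, in terms of the assignment. -/
theorem coverOf_subset_iff {x : Site k l → ZMod 2} (hx : IsEven x)
    (D : ZMod 2 → Cell k l → Fin 3 → Prop) :
    coverOf x ⊆ {e | ∀ s, s ≠ e.2.2 → ¬ D e.1 e.2.1 s} ↔
      ∀ t d s, D t d s → x (corner t d s, s) ≠ t := by
  constructor
  · intro h t d s hD hxt
    obtain ⟨o, ho, hm⟩ := (coveredIn_coverOf_iff hx).2 hxt
    exact h hm s ho hD
  · intro h e he s hs hD
    exact h _ _ _ hD (he s hs)

/-- The predicate `D` marks the triangle corners lost by deleting vertices, so one count serves all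
three boundary conditions. -/
theorem ncard_dimerCover (D : ZMod 2 → Cell k l → Fin 3 → Prop) :
    {M : Set (TriEdge k l) | IsDimerCover M ∧
        M ⊆ {e | ∀ s, s ≠ e.2.2 → ¬ D e.1 e.2.1 s}}.ncard =
      {x : Site k l → ZMod 2 | IsEven x ∧
        ∀ t d s, D t d s → x (corner t d s, s) ≠ t}.ncard := by
  rw [← (injOn_coverOf.mono fun x hx => hx.1).ncard_image]
  congr 1
  ext M
  constructor
  · rintro ⟨hM, hS⟩
    obtain ⟨x, hx, rfl⟩ := surjOn_coverOf hM
    exact ⟨x, ⟨hx, (coverOf_subset_iff hx D).1 hS⟩, rfl⟩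
  · rintro ⟨x, ⟨hx, hD⟩, rfl⟩
    exact ⟨hx.isDimerCover, (coverOf_subset_iff hx D).2 hD⟩

/-! ### Counting even assignments -/

theorem isEven_iff {x : Site k l → ZMod 2} : IsEven x ↔ ∀ i j,
    x ((i, j), 0) + x ((i, j), 1) + x ((i, j), 2) = 0 ∧
      x ((i + 1, j), 0) + x ((i, j + 1), 1) + x ((i, j), 2) = 1 := by
  have h2 : (1 + 1 : ZMod 2) = 0 := rfl
  constructor
  · intro h i j
    have h1 := h 1 (i, j)
    have h0 := h 0 (i, j)
    simp only [corner, Fin.sum_univ_three] at h1 h0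
    exact ⟨by simpa [h2] using h1, by simpa using h0⟩
  · rintro h t ⟨i, j⟩
    obtain ⟨h1, h0⟩ := h i j
    obtain rfl | rfl := zmod_two_eq t
    · simpa [corner, Fin.sum_univ_three] using h0
    · simpa [corner, Fin.sum_univ_three, h2] using h1

/-- Subtracting the two triangle equations of a cell eliminates kind 2. Summed over a column, the
kind 1 terms cancel cyclically and the constants add up to `l + 1`, which is 0 modulo 2. -/
theorem IsEven.sum_column {x : Site k l → ZMod 2} (hx : IsEven x) (hl : Even (l + 1))
    (i : Fin (k + 1)) : ∑ j, x ((i, j), 0) = ∑ j, x ((0, j), 0) := by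
  rw [isEven_iff] at hx
  have h2 : (2 : ZMod 2) = 0 := rfl
  have step : ∀ i, ∑ j, x ((i + 1, j), 0) = ∑ j, x ((i, j), 0) := by
    intro i
    have hb : ∑ j, x ((i, j + 1), 1) = ∑ j, x ((i, j), 1) :=
      Equiv.sum_comp (Equiv.addRight (1 : Fin (l + 1))) fun j => x ((i, j), 1)
    have h1 : ∑ j : Fin (l + 1),
        (x ((i + 1, j), 0) + x ((i, j + 1), 1) - x ((i, j), 0) - x ((i, j), 1)) = 0 := by
      calc _ = ∑ j : Fin (l + 1), (1 : ZMod 2) := Finset.sum_congr rfl fun j _ => by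
            linear_combination (hx i j).2 - (hx i j).1
        _ = 0 := by
          rw [Finset.sum_const, Finset.card_univ, Fintype.card_fin, nsmul_one]
          exact (ZMod.natCast_eq_zero_iff_even).2 hl
    simp only [Finset.sum_add_distrib, Finset.sum_sub_distrib] at h1
    linear_combination h1 - hb
  induction i using Fin.induction with
  | zero => rfl
  | succ i ih => rw [← ih, ← Fin.coeSucc_eq_succ, step]

/-- Partial sums of `f` solve the recursion; the vanishing total is what closes it up at the
wrap-around. -/
theorem exists_cyclic_primitive (f : Fin (l + 1) → ZMod 2) (hf : ∑ j, f j = 0) (c : ZMod 2) :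
    ∃ b : Fin (l + 1) → ZMod 2, b 0 = c ∧ ∀ j, b (j + 1) = b j + f j := by
  refine ⟨fun j => c + ∑ i ∈ Finset.univ.filter (· < j), f i, by simp, fun j => ?_⟩
  induction j using Fin.lastCases with
  | last =>
    have : (Finset.univ.filter (· < Fin.last l)) = Finset.univ.erase (Fin.last l) := by
      ext i; simp [Fin.lt_last_iff_ne_last]
    simp only [Fin.last_add_one, Fin.not_lt_zero, Finset.filter_false, Finset.sum_empty, this]
    rw [add_assoc, Finset.sum_erase_add _ _ (Finset.mem_univ _), hf]
  | cast j =>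
    have : (Finset.univ.filter (· < j.succ)) =
        insert j.castSucc (Finset.univ.filter (· < j.castSucc)) := by
      ext i; simp [Fin.lt_def, Fin.ext_iff]; omega
    beta_reduce
    rw [Fin.coeSucc_eq_succ, this, Finset.sum_insert (by simp)]
    ring

/-- Free parameters for the even assignments. -/
abbrev Param (k l : ℕ) : Type :=
  (ZMod 2 × (Fin (k + 1) → Fin l → ZMod 2)) × (Fin (k + 1) → ZMod 2)

/-- The parameters of an even assignment: the common column sum of the sites of kind `0`, the
values on these sites outside the bottom row, and the values on the sites of kind `1` in the
bottom row. -/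
def param (x : Site k l → ZMod 2) : Param k l :=
  ((∑ j, x ((0, j), 0), fun i j => x ((i, j.succ), 0)), fun i => x ((i, 0), 1))

theorem injOn_param (hl : Even (l + 1)) :
    Set.InjOn param {x : Site k l → ZMod 2 | IsEven x} := by
  intro x hx y hy h
  simp only [param, Prod.mk.injEq, funext_iff] at h
  obtain ⟨⟨hs, ha⟩, hb⟩ := h
  have h0 : ∀ i j, x ((i, j), 0) = y ((i, j), 0) := by
    intro i j
    cases j using Fin.cases with
    | succ j => exact ha i j
    | zero =>
      -- The bottom entry is the common column sum minus the remaining entries.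
      have := (hx.sum_column hl i).trans (hs.trans (hy.sum_column hl i).symm)
      rw [Fin.sum_univ_succ, Fin.sum_univ_succ (n := l)] at this
      simpa [ha] using this
  have hx := isEven_iff.1 hx
  have hy := isEven_iff.1 hy
  have h1 : ∀ i j, x ((i, j), 1) = y ((i, j), 1) := by
    intro i j
    induction j using Fin.induction with
    | zero => exact hb i
    | succ j ih =>
      rw [← Fin.coeSucc_eq_succ]
      linear_combination (hx i j.castSucc).2 - (hx i j.castSucc).1 - (hy i j.castSucc).2 +
        (hy i j.castSucc).1 - h0 (i + 1) j.castSucc + h0 i j.castSucc + ih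
  ext ⟨⟨i, j⟩, s⟩
  fin_cases s
  · exact h0 i j
  · exact h1 i j
  · show x ((i, j), 2) = y ((i, j), 2)
    linear_combination (hx i j).1 - (hy i j).1 - h0 i j - h1 i j

theorem exists_isEven_param_eq (hl : Even (l + 1)) (p : Param k l) :
    ∃ x : Site k l → ZMod 2, IsEven x ∧ param x = p := by
  obtain ⟨⟨σ, A⟩, B⟩ := p
  have h2 : (2 : ZMod 2) = 0 := rfl
  -- The bottom entry is chosen so that every column sums to `σ` in characteristic 2.
  let a : Fin (k + 1) → Fin (l + 1) → ZMod 2 := fun i => Fin.cons (σ + ∑ j, A i j) (A i)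
  have ha : ∀ i, ∑ j, a i j = σ := fun i => by
    simp only [a, Fin.sum_univ_succ, Fin.cons_zero, Fin.cons_succ]
    linear_combination (∑ j, A i j) * h2
  -- This is the solvability condition for the cyclic recursion that defines `b` along column `i`.
  have hsum : ∀ i, ∑ j, (1 + a (i + 1) j + a i j) = 0 := fun i => by
    rw [Finset.sum_add_distrib, Finset.sum_add_distrib, ha, ha, Finset.sum_const,
      Finset.card_univ, Fintype.card_fin, nsmul_one, (ZMod.natCast_eq_zero_iff_even).2 hl]
    linear_combination σ * h2
  choose b hb0 hb using fun i => exists_cyclic_primitive _ (hsum i) (B i)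
  refine ⟨fun v => ![a v.1.1 v.1.2, b v.1.1 v.1.2, a v.1.1 v.1.2 + b v.1.1 v.1.2] v.2, ?_, ?_⟩
  · rw [isEven_iff]
    intro i j
    simp only [Matrix.cons_val_zero, Matrix.cons_val_one, Matrix.cons_val, hb]
    constructor
    · linear_combination (a i j + b i j) * h2
    · linear_combination (a i j + b i j + a (i + 1) j) * h2
  · simp only [param, Matrix.cons_val_zero, Matrix.cons_val_one, ha, hb0]
    simp [a]

theorem ncard_isEven_param (hl : Even (l + 1)) (Q : Set (Param k l)) :
    {x : Site k l → ZMod 2 | IsEven x ∧ param x ∈ Q}.ncard = Q.ncard := by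
  rw [← ((injOn_param hl).mono fun x hx => hx.1).ncard_image]
  congr 1
  ext p
  constructor
  · rintro ⟨x, ⟨-, h⟩, rfl⟩
    exact h
  · intro hp
    obtain ⟨x, hx, rfl⟩ := exists_isEven_param_eq hl p
    exact ⟨x, ⟨hx, hp⟩, rfl⟩

theorem ncard_isEven (hl : Even (l + 1)) :
    {x : Site k l → ZMod 2 | IsEven x}.ncard = 2 ^ ((k + 1) * (l + 1) + 1) := by
  have := ncard_isEven_param (k := k) hl Set.univ
  simp only [Set.mem_univ, and_true] at this
  rw [this, Set.ncard_univ, Nat.card_eq_fintype_card]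
  simp only [Fintype.card_prod, Fintype.card_fun, ZMod.card, Fintype.card_fin]
  ring

theorem ncard_isEven_of_row (hl : Even (l + 1)) :
    {x : Site k l → ZMod 2 | IsEven x ∧ ∀ i, x ((i, 0), 1) = 1}.ncard =
      2 ^ ((k + 1) * l + 1) := by
  have := ncard_isEven_param (k := k) hl (Set.univ ×ˢ {1})
  rw [Set.ncard_prod, Set.ncard_univ, Set.ncard_singleton, Nat.card_eq_fintype_card] at this
  simp only [Fintype.card_prod, Fintype.card_fun, ZMod.card, Fintype.card_fin, Set.mem_prod,
    Set.mem_univ, true_and, Set.mem_singleton_iff, funext_iff, param, Pi.one_apply] at this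
  rw [this]
  ring

theorem ncard_isEven_of_row_of_column (hl : Even (l + 1)) :
    {x : Site k l → ZMod 2 | IsEven x ∧ (∀ i, x ((i, 0), 1) = 1) ∧
      ∀ j, x ((0, j), 0) = 1}.ncard = 2 ^ (k * l) := by
  have hA : {A : Fin (k + 1) → Fin l → ZMod 2 | A 0 = 1}.ncard = 2 ^ (k * l) := by
    have : {A : Fin (k + 1) → Fin l → ZMod 2 | A 0 = 1} =
        Set.range fun A : Fin k → Fin l → ZMod 2 =>
          (Fin.cons 1 A : Fin (k + 1) → Fin l → ZMod 2) := by
      ext A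
      constructor
      · intro h
        exact ⟨Fin.tail A, by rw [← show A 0 = 1 from h]; exact Fin.cons_self_tail A⟩
      · rintro ⟨A, rfl⟩
        rfl
    have inj : Function.Injective fun A : Fin k → Fin l → ZMod 2 =>
        (Fin.cons 1 A : Fin (k + 1) → Fin l → ZMod 2) := by
      intro A A' h
      simpa using congrArg Fin.tail h
    rw [this, ← Set.image_univ, Set.ncard_image_of_injective _ inj, Set.ncard_univ,
      Nat.card_eq_fintype_card]
    simp only [Fintype.card_fun, ZMod.card, Fintype.card_fin]
    ring
  -- A first column of ones has sum `l + 1`, hence the column-sum parameter 0; conversely, that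
  -- parameter forces the bottom entry to be 1 once the others are.
  have := ncard_isEven_param (k := k) hl (({0} ×ˢ {A | A 0 = 1}) ×ˢ {1})
  rw [Set.ncard_prod, Set.ncard_prod, Set.ncard_singleton, Set.ncard_singleton, hA] at this
  rw [one_mul, mul_one] at this
  rw [← this]
  congr 1
  ext x
  simp only [Set.mem_ofPred_eq, Set.mem_prod, Set.mem_singleton_iff, param, funext_iff,
    Pi.one_apply]
  have hone : ∑ j : Fin (l + 1), (1 : ZMod 2) = 0 := by
    rw [Finset.sum_const, Finset.card_univ, Fintype.card_fin, nsmul_one]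
    exact (ZMod.natCast_eq_zero_iff_even).2 hl
  constructor
  · rintro ⟨h, hb, ha⟩
    exact ⟨h, ⟨by simp only [ha, hone], fun j => ha _⟩, hb⟩
  · rintro ⟨h, ⟨hs, ha⟩, hb⟩
    refine ⟨h, hb, fun j => ?_⟩
    cases j using Fin.cases with
    | succ j => exact ha j
    | zero =>
      rw [← hone, Fin.sum_univ_succ, Fin.sum_univ_succ] at hs
      simpa [ha] using hs

/-! ### Geometry of the patch and of its quotients -/

/-- The position in the patch of the corner of kind `s` of the triangle of type `t` that belongs to
the cell `d`. -/
def cornerPos (t : ZMod 2) (d : Cell k l) (s : Fin 3) : ℤ × ℤ :=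
  if s = 2 then (2 * (d.1 : ℤ) + 1, 2 * (d.2 : ℤ) + 1)
  else if s = 0 then (2 * (d.1 : ℤ) + (if t = 1 then 0 else 2), 2 * (d.2 : ℤ) + 1)
  else (2 * (d.1 : ℤ) + 1, 2 * (d.2 : ℤ) + (if t = 1 then 0 else 2))

/-- The position of a site after all identifications. -/
def sitePos (v : Site k l) : ℤ × ℤ := cornerPos 1 v.1 v.2

/-- The edge of the patch with the given labels. -/
def edgePos (e : TriEdge k l) : Sym2 (ℤ × ℤ) :=
  s(cornerPos e.1 e.2.1 (e.2.2 + 1), cornerPos e.1 e.2.1 (e.2.2 + 2))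

theorem cornerPos_zero (t : ZMod 2) (d : Cell k l) : cornerPos t d 0 =
    (2 * (d.1 : ℤ) + (if t = 1 then 0 else 2), 2 * (d.2 : ℤ) + 1) := rfl

theorem cornerPos_one (t : ZMod 2) (d : Cell k l) : cornerPos t d 1 =
    (2 * (d.1 : ℤ) + 1, 2 * (d.2 : ℤ) + (if t = 1 then 0 else 2)) := rfl

theorem cornerPos_two (t : ZMod 2) (d : Cell k l) : cornerPos t d 2 =
    (2 * (d.1 : ℤ) + 1, 2 * (d.2 : ℤ) + 1) := rfl

theorem sitePos_injective : Function.Injective (sitePos : Site k l → ℤ × ℤ) := by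
  rintro ⟨⟨i, j⟩, s⟩ ⟨⟨i', j'⟩, s'⟩ h
  fin_cases s <;> fin_cases s' <;>
    simp [sitePos, cornerPos_zero, cornerPos_one, cornerPos_two, Prod.ext_iff, Fin.ext_iff]
      at h ⊢ <;> omega

/-- Edges are labelled by their positions before gluing, so the parallel edges arising for `n = 1`
stay distinct. -/
theorem edgePos_injective : Function.Injective (edgePos : TriEdge k l → Sym2 (ℤ × ℤ)) := by
  rintro ⟨t, ⟨i, j⟩, o⟩ ⟨t', ⟨i', j'⟩, o'⟩ h
  obtain rfl | rfl := zmod_two_eq t <;> obtain rfl | rfl := zmod_two_eq t' <;> fin_cases o <;> fin_cases o' <;>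
    simp [edgePos, cornerPos, Prod.ext_iff, Fin.ext_iff] at h ⊢ <;> omega

theorem exists_cell {n m : ℕ} (hn : k + 1 = n) (hm : l + 1 = 2 * m) {a b : ℤ} (ha : 0 ≤ a)
    (ha' : a < n) (hb : 0 ≤ b) (hb' : b < 2 * m) :
    ∃ d : Cell k l, (d.1 : ℤ) = a ∧ (d.2 : ℤ) = b :=
  ⟨(⟨a.toNat, by omega⟩, ⟨b.toNat, by omega⟩), by simp [ha], by simp [hb]⟩

theorem cornerPos_mem_patchSites {n m : ℕ} (hn : k + 1 = n) (hm : l + 1 = 2 * m) (t : ZMod 2)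
    (d : Cell k l) (s : Fin 3) : cornerPos t d s ∈ patchSites n m := by
  obtain ⟨⟨i, hi⟩, ⟨j, hj⟩⟩ := d
  simp only [patchSites, Set.mem_ofPred_eq, cornerPos, Int.odd_iff]
  split_ifs <;> dsimp only <;> omega

theorem exists_cornerPos_eq {n m : ℕ} (hn : k + 1 = n) (hm : l + 1 = 2 * m) {p : ℤ × ℤ}
    (hp : p ∈ patchSites n m) : ∃ t, ∃ d : Cell k l, ∃ s, cornerPos t d s = p := by
  obtain ⟨a, b⟩ := p
  simp only [patchSites, Set.mem_ofPred_eq, Int.odd_iff] at hp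
  by_cases ha : a % 2 = 1
  · by_cases hb : b % 2 = 1
    · obtain ⟨d, h1, h2⟩ := exists_cell hn hm (a := a / 2) (b := b / 2) (by omega) (by omega)
        (by omega) (by omega)
      exact ⟨1, d, 2, by rw [cornerPos_two, h1, h2]; ext <;> dsimp only <;> omega⟩
    · by_cases hb' : b = 4 * m
      · obtain ⟨d, h1, h2⟩ := exists_cell hn hm (a := a / 2) (b := b / 2 - 1) (by omega) (by omega)
          (by omega) (by omega)
        refine ⟨0, d, 1, ?_⟩
        rw [cornerPos_one, h1, h2, if_neg (by decide)]; ext <;> dsimp only <;> omega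
      · obtain ⟨d, h1, h2⟩ := exists_cell hn hm (a := a / 2) (b := b / 2) (by omega) (by omega)
          (by omega) (by omega)
        refine ⟨1, d, 1, ?_⟩
        rw [cornerPos_one, h1, h2, if_pos rfl]; ext <;> dsimp only <;> omega
  · by_cases ha' : a = 2 * n
    · obtain ⟨d, h1, h2⟩ := exists_cell hn hm (a := a / 2 - 1) (b := b / 2) (by omega) (by omega)
        (by omega) (by omega)
      refine ⟨0, d, 0, ?_⟩
      rw [cornerPos_zero, h1, h2, if_neg (by decide)]; ext <;> dsimp only <;> omega
    · obtain ⟨d, h1, h2⟩ := exists_cell hn hm (a := a / 2) (b := b / 2) (by omega) (by omega)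
        (by omega) (by omega)
      refine ⟨1, d, 0, ?_⟩
      rw [cornerPos_zero, h1, h2, if_pos rfl]; ext <;> dsimp only <;> omega

theorem triangularLattice_adj {x y : ℤ × ℤ} : triangularLattice.Adj x y ↔
    (y = x + (1, 0) ∨ y = x + (0, 1) ∨ y = x + (1, -1)) ∨
      (x = y + (1, 0) ∨ x = y + (0, 1) ∨ x = y + (1, -1)) := by
  rw [triangularLattice, SimpleGraph.fromRel_adj, and_iff_right_iff_imp]
  rintro h rfl
  simp [Prod.ext_iff] at h

theorem patch_isLink {n m : ℕ} {e : Sym2 (ℤ × ℤ)} {x y : ℤ × ℤ} :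
    (patch n m).IsLink e x y ↔
      e = s(x, y) ∧ triangularLattice.Adj x y ∧ x ∈ patchSites n m ∧ y ∈ patchSites n m := by
  rw [patch, Graph.induce_isLink]
  simp only [Graph.ofSimpleGraph]
  constructor
  · rintro ⟨⟨rfl, h⟩, hx, hy⟩
    exact ⟨rfl, h, hx, hy⟩
  · rintro ⟨rfl, h, hx, hy⟩
    exact ⟨⟨rfl, h⟩, hx, hy⟩

theorem cornerPos_adj (t : ZMod 2) (d : Cell k l) {r s : Fin 3} (h : r ≠ s) :
    triangularLattice.Adj (cornerPos t d r) (cornerPos t d s) := by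
  rw [triangularLattice_adj]
  by_cases ht : t = 1 <;> fin_cases r <;> fin_cases s <;>
    first
    | exact absurd rfl h
    | (simp [cornerPos, ht, Prod.ext_iff]; try omega)

/-- The parity of a coordinate of the starting point decides the type of the triangle containing the
step. -/
theorem exists_triangle_of_step {n m : ℕ} (hn : k + 1 = n) (hm : l + 1 = 2 * m) {x y : ℤ × ℤ}
    (hx : x ∈ patchSites n m) (hy : y ∈ patchSites n m)
    (h : y = x + (1, 0) ∨ y = x + (0, 1) ∨ y = x + (1, -1)) :
    ∃ t, ∃ d : Cell k l, ∃ r s, r ≠ s ∧ cornerPos t d r = x ∧ cornerPos t d s = y := by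
  obtain ⟨a, b⟩ := x
  obtain ⟨a', b'⟩ := y
  simp only [patchSites, Set.mem_ofPred_eq, Int.odd_iff] at hx hy
  simp only [Prod.mk_add_mk, Prod.mk.injEq] at h
  have h01 : (0 : ZMod 2) ≠ 1 := by decide
  have find : ∀ (t : ZMod 2) (i j : ℤ) (r s : Fin 3), r ≠ s → 0 ≤ i → i < n → 0 ≤ j → j < 2 * m →
      (∀ d : Cell k l, (d.1 : ℤ) = i → (d.2 : ℤ) = j →
        cornerPos t d r = (a, b) ∧ cornerPos t d s = (a', b')) →
      ∃ t, ∃ d : Cell k l, ∃ r s, r ≠ s ∧ cornerPos t d r = (a, b) ∧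
        cornerPos t d s = (a', b') := by
    intro t i j r s hrs h1 h2 h3 h4 hd
    obtain ⟨d, hi, hj⟩ := exists_cell hn hm h1 h2 h3 h4
    exact ⟨t, d, r, s, hrs, hd d hi hj⟩
  rcases h with h | h | h
  · by_cases ha : a % 2 = 1
    · refine find 0 (a / 2) (b / 2) 2 0 (by decide) (by omega) (by omega) (by omega) (by omega)
        fun d hi hj => ?_
      simp only [cornerPos_zero, cornerPos_two, hi, hj, h01, if_false, Prod.mk.injEq]
      omega
    · refine find 1 (a / 2) (b / 2) 0 2 (by decide) (by omega) (by omega) (by omega) (by omega)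
        fun d hi hj => ?_
      simp only [cornerPos_zero, cornerPos_two, hi, hj, if_true, Prod.mk.injEq]
      omega
  · by_cases hb : b % 2 = 1
    · refine find 0 (a / 2) (b / 2) 2 1 (by decide) (by omega) (by omega) (by omega) (by omega)
        fun d hi hj => ?_
      simp only [cornerPos_one, cornerPos_two, hi, hj, h01, if_false, Prod.mk.injEq]
      omega
    · refine find 1 (a / 2) (b / 2) 1 2 (by decide) (by omega) (by omega) (by omega) (by omega)
        fun d hi hj => ?_
      simp only [cornerPos_one, cornerPos_two, hi, hj, if_true, Prod.mk.injEq]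
      omega
  -- Here the start is the kind 1 corner of a type 0 triangle, which lies at the top of its cell;
  -- hence the row `b / 2 - 1`.
  · by_cases ha : a % 2 = 1
    · refine find 0 (a / 2) (b / 2 - 1) 1 0 (by decide) (by omega) (by omega) (by omega) (by omega)
        fun d hi hj => ?_
      simp only [cornerPos_zero, cornerPos_one, hi, hj, h01, if_false, Prod.mk.injEq]
      omega
    · refine find 1 (a / 2) (b / 2) 0 1 (by decide) (by omega) (by omega) (by omega) (by omega)
        fun d hi hj => ?_
      simp only [cornerPos_zero, cornerPos_one, hi, hj, if_true, Prod.mk.injEq]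
      omega

theorem edgePos_eq {t : ZMod 2} {d : Cell k l} {o r s : Fin 3} (hr : r ≠ o) (hs : s ≠ o)
    (hrs : r ≠ s) : edgePos (t, d, o) = s(cornerPos t d r, cornerPos t d s) := by
  have : ∀ o r s : Fin 3, r ≠ o → s ≠ o → r ≠ s →
      (r = o + 1 ∧ s = o + 2) ∨ (r = o + 2 ∧ s = o + 1) := by decide
  obtain ⟨rfl, rfl⟩ | ⟨rfl, rfl⟩ := this o r s hr hs hrs
  · rfl
  · exact Sym2.eq_swap

theorem patch_isLink_iff {n m : ℕ} (hn : k + 1 = n) (hm : l + 1 = 2 * m) {e : Sym2 (ℤ × ℤ)}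
    {x y : ℤ × ℤ} : (patch n m).IsLink e x y ↔
      ∃ t, ∃ d : Cell k l, ∃ o r s, r ≠ o ∧ s ≠ o ∧ r ≠ s ∧ e = edgePos (t, d, o) ∧
        cornerPos t d r = x ∧ cornerPos t d s = y := by
  have third : ∀ r s : Fin 3, ∃ o, r ≠ o ∧ s ≠ o := by decide
  rw [patch_isLink]
  constructor
  · rintro ⟨rfl, hadj, hx, hy⟩
    rw [triangularLattice_adj] at hadj
    rcases hadj with h | h
    · obtain ⟨t, d, r, s, hrs, rfl, rfl⟩ := exists_triangle_of_step hn hm hx hy h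
      obtain ⟨o, hr, hs⟩ := third r s
      exact ⟨t, d, o, r, s, hr, hs, hrs, (edgePos_eq hr hs hrs).symm, rfl, rfl⟩
    · obtain ⟨t, d, r, s, hrs, rfl, rfl⟩ := exists_triangle_of_step hn hm hy hx h
      obtain ⟨o, hr, hs⟩ := third r s
      exact ⟨t, d, o, s, r, hs, hr, hrs.symm, (edgePos_eq hs hr hrs.symm).symm, rfl, rfl⟩
  · rintro ⟨t, d, o, r, s, hr, hs, hrs, rfl, rfl, rfl⟩
    exact ⟨edgePos_eq hr hs hrs, cornerPos_adj t d hrs, cornerPos_mem_patchSites hn hm t d r,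
      cornerPos_mem_patchSites hn hm t d s⟩

/-- `G` is obtained from the patch by deleting the vertices in `X` and identifying other vertices
in the way of the torus. -/
structure IsPatchQuotient (k l n m : ℕ) (X : Set (ℤ × ℤ)) (g : ℤ × ℤ → ℤ × ℤ)
    (G : Graph (ℤ × ℤ) (Sym2 (ℤ × ℤ))) : Prop where
  columns : k + 1 = n
  rows : l + 1 = 2 * m
  eq_map : G = ((patch n m).deleteVerts X).map g
  glue : ∀ t (d : Cell k l) s, cornerPos t d s ∉ X →
    g (cornerPos t d s) = sitePos (corner t d s, s)
  sitePos_notMem : ∀ v : Site k l, sitePos v ∉ X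

namespace IsPatchQuotient

variable {n m : ℕ} {X : Set (ℤ × ℤ)} {g : ℤ × ℤ → ℤ × ℤ} {G : Graph (ℤ × ℤ) (Sym2 (ℤ × ℤ))}

/-- Only second copies of sites are deleted, so all three graphs have the vertex set of the torus
and differ only in their edges. -/
theorem vertexSet_eq (h : IsPatchQuotient k l n m X g G) :
    V(G) = Set.range (sitePos : Site k l → ℤ × ℤ) := by
  rw [h.eq_map, Graph.vertexSet_map, Graph.vertexSet_deleteVerts]
  ext w
  constructor
  · rintro ⟨p, ⟨hp, hX⟩, rfl⟩
    obtain ⟨t, d, s, rfl⟩ := exists_cornerPos_eq h.columns h.rows hp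
    exact ⟨_, (h.glue t d s hX).symm⟩
  · rintro ⟨⟨d, s⟩, rfl⟩
    exact ⟨cornerPos 1 d s, ⟨cornerPos_mem_patchSites h.columns h.rows 1 d s,
      h.sitePos_notMem (d, s)⟩, h.glue 1 d s (h.sitePos_notMem (d, s))⟩

theorem inc_iff (h : IsPatchQuotient k l n m X g G) {e' : Sym2 (ℤ × ℤ)} {w : ℤ × ℤ} :
    G.Inc e' w ↔ ∃ e : TriEdge k l, (∀ s, s ≠ e.2.2 → cornerPos e.1 e.2.1 s ∉ X) ∧
      ∃ v, e' = edgePos e ∧ w = sitePos v ∧ e.Inc v := by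
  have other : ∀ o r : Fin 3, r ≠ o → ∃ s, s ≠ o ∧ r ≠ s := by decide
  have third : ∀ o r s q : Fin 3, r ≠ o → s ≠ o → r ≠ s → q ≠ o → q = r ∨ q = s := by decide
  rw [h.eq_map, Graph.map_inc]
  simp only [Graph.Inc, Graph.deleteVerts_isLink, patch_isLink_iff h.columns h.rows]
  constructor
  · rintro ⟨_, ⟨_, ⟨t, d, o, r, s, hr, hs, hrs, rfl, rfl, rfl⟩, hx, hy⟩, rfl⟩
    refine ⟨(t, d, o), fun q hq => ?_, (corner t d r, r), rfl, h.glue t d r hx, hr, rfl⟩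
    obtain rfl | rfl := third o r s q hr hs hrs hq
    · exact hx
    · exact hy
  · rintro ⟨⟨t, d, o⟩, hX, ⟨c, r⟩, rfl, rfl, hr, hc⟩
    obtain rfl : corner t d r = c := hc
    obtain ⟨s, hs, hrs⟩ := other o r hr
    exact ⟨cornerPos t d r, ⟨cornerPos t d s, ⟨t, d, o, r, s, hr, hs, hrs, rfl, rfl, rfl⟩,
      hX r hr, hX s hs⟩, (h.glue t d r (hX r hr)).symm⟩

/-- Loops cannot occur, even after gluing, because the ends of an edge are of different kinds. -/
theorem isPerfectMatching_iff (h : IsPatchQuotient k l n m X g G) {N : Set (Sym2 (ℤ × ℤ))} :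
    IsPerfectMatching G N ↔ ∃ M : Set (TriEdge k l), (IsDimerCover M ∧
      M ⊆ {e | ∀ s, s ≠ e.2.2 → ¬ cornerPos e.1 e.2.1 s ∈ X}) ∧ edgePos '' M = N := by
  have two : ∀ o : Fin 3, ∃ r s, r ≠ o ∧ s ≠ o ∧ r ≠ s := by decide
  constructor
  · rintro ⟨hE, -, hV⟩
    have edge : ∀ e ∈ N, ∃ e₀ : TriEdge k l,
        (∀ s, s ≠ e₀.2.2 → cornerPos e₀.1 e₀.2.1 s ∉ X) ∧ e = edgePos e₀ := by
      intro e he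
      obtain ⟨x, y, hxy⟩ := Graph.exists_isLink_of_mem_edgeSet (hE he)
      obtain ⟨e₀, h₀, v, rfl, -⟩ := h.inc_iff.1 hxy.inc_left
      exact ⟨e₀, h₀, rfl⟩
    have allowed : ∀ e : TriEdge k l, edgePos e ∈ N →
        ∀ s, s ≠ e.2.2 → cornerPos e.1 e.2.1 s ∉ X := by
      intro e he
      obtain ⟨e₀, h₀, h₁⟩ := edge _ he
      rwa [edgePos_injective h₁]
    refine ⟨edgePos ⁻¹' N, ⟨fun v => ?_, fun e he => allowed e he⟩, ?_⟩
    · obtain ⟨e, ⟨heN, hev⟩, hu⟩ := hV (sitePos v) (by rw [h.vertexSet_eq]; exact ⟨v, rfl⟩)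
      obtain ⟨e₀, -, v', rfl, hv, hinc⟩ := h.inc_iff.1 hev
      obtain rfl := sitePos_injective hv
      refine ⟨e₀, ⟨heN, hinc⟩, fun e₁ ⟨h₁, h₁'⟩ => edgePos_injective (hu _ ⟨h₁, ?_⟩)⟩
      exact h.inc_iff.2 ⟨e₁, allowed e₁ h₁, v, rfl, rfl, h₁'⟩
    · rw [Set.image_preimage_eq_iff]
      intro e he
      obtain ⟨e₀, -, rfl⟩ := edge e he
      exact ⟨e₀, rfl⟩
  · rintro ⟨M, ⟨hM, hX⟩, rfl⟩
    refine ⟨?_, ?_, ?_⟩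
    · rintro _ ⟨⟨t, d, o⟩, he, rfl⟩
      obtain ⟨r, -, hr, -, -⟩ := two o
      exact Graph.Inc.edge_mem (h.inc_iff.2 ⟨_, hX he, (corner t d r, r), rfl, rfl, hr, rfl⟩)
    · rintro _ ⟨⟨t, d, o⟩, he, rfl⟩ x hloop
      obtain ⟨r, s, hr, hs, hrs⟩ := two o
      have h1 := hloop.eq_of_inc (h.inc_iff.2 ⟨_, hX he, (corner t d r, r), rfl, rfl, hr, rfl⟩)
      have h2 := hloop.eq_of_inc (h.inc_iff.2 ⟨_, hX he, (corner t d s, s), rfl, rfl, hs, rfl⟩)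
      exact hrs (congrArg Prod.snd (sitePos_injective (h1.symm.trans h2)))
    · intro x hx
      rw [h.vertexSet_eq] at hx
      obtain ⟨v, rfl⟩ := hx
      obtain ⟨e, ⟨he, hev⟩, hu⟩ := hM v
      refine ⟨edgePos e, ⟨⟨e, he, rfl⟩, h.inc_iff.2 ⟨e, hX he, v, rfl, rfl, hev⟩⟩, ?_⟩
      rintro _ ⟨⟨e₁, he₁, rfl⟩, hinc⟩
      obtain ⟨e₂, -, v', h2, hv, hinc⟩ := h.inc_iff.1 hinc
      obtain rfl := edgePos_injective h2
      obtain rfl := sitePos_injective hv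
      rw [hu e₁ ⟨he₁, hinc⟩]

theorem numPerfectMatchings_eq (h : IsPatchQuotient k l n m X g G) :
    numPerfectMatchings G = {x : Site k l → ZMod 2 | IsEven x ∧
      ∀ t d s, cornerPos t d s ∈ X → x (corner t d s, s) ≠ t}.ncard := by
  rw [← ncard_dimerCover fun t d s => cornerPos t d s ∈ X,
    ← Set.ncard_image_of_injective _ edgePos_injective.image_injective]
  exact congrArg Set.ncard (Set.ext fun N => h.isPerfectMatching_iff)

theorem ncard_vertexSet (h : IsPatchQuotient k l n m X g G) : V(G).ncard = 6 * (n * m) := by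
  rw [h.vertexSet_eq, ← Set.image_univ, Set.ncard_image_of_injective _ sitePos_injective,
    Set.ncard_univ, Nat.card_eq_fintype_card]
  simp only [Fintype.card_prod, Fintype.card_fin, h.columns, h.rows]
  ring

end IsPatchQuotient

/-! ### The three boundary conditions -/

/-- This puts the cyclic successor into a form usable by linear arithmetic. -/
theorem val_add_one_cyclic (i : Fin (k + 1)) :
    (((i + 1 : Fin (k + 1)) : ℕ) = 0 ∧ (i : ℕ) = k) ∨
      (((i + 1 : Fin (k + 1)) : ℕ) = i + 1 ∧ (i : ℕ) < k) := by
  rw [Fin.val_add_one]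
  split_ifs with h
  · exact Or.inl ⟨rfl, by rw [h]; rfl⟩
  · exact Or.inr ⟨rfl, Fin.val_lt_last h⟩

theorem glueV_glueU_cornerPos {n m : ℕ} (hn : k + 1 = n) (hm : l + 1 = 2 * m) (t : ZMod 2)
    (d : Cell k l) (s : Fin 3) :
    glueV m (glueU n (cornerPos t d s)) = sitePos (corner t d s, s) := by
  obtain ⟨i, j⟩ := d
  have hi := val_add_one_cyclic i
  have hj := val_add_one_cyclic j
  obtain rfl | rfl := zmod_two_eq t <;> fin_cases s <;>
    simp [glueV, glueU, sitePos, corner, cornerPos] <;>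
    generalize i + 1 = i' at * <;> generalize j + 1 = j' at * <;> split_ifs <;>
    simp [Prod.ext_iff, -Fin.val_eq_zero_iff] <;> omega

theorem glueV_eq_self {m : ℕ} {p : ℤ × ℤ} (h : p.2 ≠ 4 * m) : glueV m p = p := if_neg h

theorem glueU_eq_self {n : ℕ} {p : ℤ × ℤ} (h : p.1 ≠ 2 * n) : glueU n p = p := if_neg h

theorem glueU_snd (n : ℕ) (p : ℤ × ℤ) : (glueU n p).2 = p.2 := by
  unfold glueU
  split_ifs <;> rfl

theorem cornerPos_mem_vStars_iff {n m : ℕ} (hn : k + 1 = n) (hm : l + 1 = 2 * m) {t : ZMod 2}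
    {d : Cell k l} {s : Fin 3} :
    cornerPos t d s ∈ vStars n m ↔ t = 0 ∧ s = 1 ∧ d.2 = Fin.last l := by
  obtain ⟨⟨i, hi⟩, ⟨j, hj⟩⟩ := d
  have h1 : (1 : ZMod 2) ≠ 0 := by decide
  simp only [vStars, Set.mem_ofPred_eq, Fin.ext_iff (n := l + 1), Fin.val_last]
  constructor
  · rintro ⟨a, ha, ha', h⟩
    obtain rfl | rfl := zmod_two_eq t <;> fin_cases s <;>
      simp [cornerPos, Prod.ext_iff] at h ⊢ <;> omega
  · rintro ⟨rfl, rfl, h⟩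
    refine ⟨i + 1, by omega, by omega, ?_⟩
    simp only [cornerPos_one, h1.symm, if_false, Prod.mk.injEq] at h ⊢
    omega

theorem cornerPos_mem_uStars_iff {n m : ℕ} (hn : k + 1 = n) (hm : l + 1 = 2 * m) {t : ZMod 2}
    {d : Cell k l} {s : Fin 3} :
    cornerPos t d s ∈ uStars n m ↔ t = 0 ∧ s = 0 ∧ d.1 = Fin.last k := by
  obtain ⟨⟨i, hi⟩, ⟨j, hj⟩⟩ := d
  have h1 : (1 : ZMod 2) ≠ 0 := by decide
  simp only [uStars, Set.mem_ofPred_eq, Fin.ext_iff (n := k + 1), Fin.val_last]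
  constructor
  · rintro ⟨a, ha, ha', h⟩
    obtain rfl | rfl := zmod_two_eq t <;> fin_cases s <;>
      simp [cornerPos, Prod.ext_iff] at h ⊢ <;> omega
  · rintro ⟨rfl, rfl, h⟩
    refine ⟨j + 1, by omega, by omega, ?_⟩
    simp only [cornerPos_zero, h1.symm, if_false, Prod.mk.injEq] at h ⊢
    omega

theorem cornerPos_snd_ne {n m : ℕ} (hn : k + 1 = n) (hm : l + 1 = 2 * m) {t : ZMod 2}
    {d : Cell k l} {s : Fin 3} (h : cornerPos t d s ∉ vStars n m) :
    (cornerPos t d s).2 ≠ 4 * m := by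
  rw [cornerPos_mem_vStars_iff hn hm, Fin.ext_iff (n := l + 1), Fin.val_last] at h
  obtain ⟨⟨i, hi⟩, ⟨j, hj⟩⟩ := d
  obtain rfl | rfl := zmod_two_eq t <;> fin_cases s <;> simp [cornerPos] at h ⊢ <;> omega

theorem cornerPos_fst_ne {n m : ℕ} (hn : k + 1 = n) (hm : l + 1 = 2 * m) {t : ZMod 2}
    {d : Cell k l} {s : Fin 3} (h : cornerPos t d s ∉ uStars n m) :
    (cornerPos t d s).1 ≠ 2 * n := by
  rw [cornerPos_mem_uStars_iff hn hm, Fin.ext_iff (n := k + 1), Fin.val_last] at h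
  obtain ⟨⟨i, hi⟩, ⟨j, hj⟩⟩ := d
  obtain rfl | rfl := zmod_two_eq t <;> fin_cases s <;> simp [cornerPos] at h ⊢ <;> omega

theorem map_map_eq {α α' α'' β : Type*} (G : Graph α β) (f : α → α') (g : α' → α'') :
    (G.map f).map g = G.map (g ∘ f) := by
  refine Graph.ext_inc ?_ fun e x => ?_
  · simp only [Graph.vertexSet_map, Set.image_image, Function.comp_apply]
  · simp only [Graph.map_inc, Function.comp_apply]
    constructor
    · rintro ⟨_, ⟨v, hv, rfl⟩, rfl⟩
      exact ⟨v, hv, rfl⟩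
    · rintro ⟨v, hv, rfl⟩
      exact ⟨_, ⟨v, hv, rfl⟩, rfl⟩

theorem map_id_eq {α β : Type*} (G : Graph α β) : G.map id = G := by
  refine Graph.ext_inc ?_ fun e x => ?_
  · simp
  · simp

theorem isPatchQuotient_torus {n m : ℕ} (hn : k + 1 = n) (hm : l + 1 = 2 * m) :
    IsPatchQuotient k l n m ∅ (glueV m ∘ glueU n) (kagomeTorus n m) where
  columns := hn
  rows := hm
  eq_map := by rw [kagomeTorus, map_map_eq, Graph.deleteVerts_empty]
  glue t d s _ := glueV_glueU_cornerPos hn hm t d s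
  sitePos_notMem _ := Set.notMem_empty _

theorem isPatchQuotient_cylinder {n m : ℕ} (hn : k + 1 = n) (hm : l + 1 = 2 * m) :
    IsPatchQuotient k l n m (vStars n m) (glueU n) (kagomeCylinder n m) where
  columns := hn
  rows := hm
  eq_map := rfl
  glue t d s h := by
    rw [← glueV_glueU_cornerPos hn hm, glueV_eq_self]
    rw [glueU_snd]
    exact cornerPos_snd_ne hn hm h
  sitePos_notMem v := by
    rw [sitePos, cornerPos_mem_vStars_iff hn hm]
    exact fun h => absurd h.1 (by decide)

theorem isPatchQuotient_free {n m : ℕ} (hn : k + 1 = n) (hm : l + 1 = 2 * m) :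
    IsPatchQuotient k l n m (uStars n m ∪ vStars n m) id (kagomeFree n m) where
  columns := hn
  rows := hm
  eq_map := by rw [map_id_eq, kagomeFree]
  glue t d s h := by
    rw [Set.mem_union, not_or] at h
    rw [← glueV_glueU_cornerPos hn hm, glueU_eq_self (cornerPos_fst_ne hn hm h.1),
      glueV_eq_self (cornerPos_snd_ne hn hm h.2), id]
  sitePos_notMem v := by
    rw [Set.mem_union, sitePos, cornerPos_mem_vStars_iff hn hm, cornerPos_mem_uStars_iff hn hm]
    exact fun h => h.elim (fun h => absurd h.1 (by decide)) fun h => absurd h.1 (by decide)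

theorem zmod_two_ne_zero_iff (a : ZMod 2) : a ≠ 0 ↔ a = 1 := by decide +revert

/-- The deleted corners are the kind 1 corners of the type 0 triangles in the last row, which wrap
around to row 0. Avoiding type 0 there means having the value 1. -/
theorem forall_vStars_iff {n m : ℕ} (hn : k + 1 = n) (hm : l + 1 = 2 * m)
    (x : Site k l → ZMod 2) :
    (∀ t d s, cornerPos t d s ∈ vStars n m → x (corner t d s, s) ≠ t) ↔
      ∀ i, x ((i, 0), 1) = 1 := by
  simp only [cornerPos_mem_vStars_iff hn hm]
  constructor
  · intro h i
    have := h 0 (i, Fin.last l) 1 ⟨rfl, rfl, rfl⟩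
    rw [← zmod_two_ne_zero_iff]
    simpa [corner] using this
  · rintro h _ ⟨i, _⟩ _ ⟨rfl, rfl, rfl⟩
    simp [corner, h]

theorem forall_uStars_iff {n m : ℕ} (hn : k + 1 = n) (hm : l + 1 = 2 * m)
    (x : Site k l → ZMod 2) :
    (∀ t d s, cornerPos t d s ∈ uStars n m → x (corner t d s, s) ≠ t) ↔
      ∀ j, x ((0, j), 0) = 1 := by
  simp only [cornerPos_mem_uStars_iff hn hm]
  constructor
  · intro h j
    have := h 0 (Fin.last k, j) 0 ⟨rfl, rfl, rfl⟩
    rw [← zmod_two_ne_zero_iff]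
    simpa [corner] using this
  · rintro h _ ⟨_, j⟩ _ ⟨rfl, rfl, rfl⟩
    simp [corner, h]

theorem numPerfectMatchings_torus {n m : ℕ} (hn : k + 1 = n) (hm : l + 1 = 2 * m) :
    numPerfectMatchings (kagomeTorus n m) = 2 ^ ((k + 1) * (l + 1) + 1) := by
  rw [(isPatchQuotient_torus hn hm).numPerfectMatchings_eq,
    ← ncard_isEven (k := k) (l := l) ⟨m, by omega⟩]
  simp

theorem numPerfectMatchings_cylinder {n m : ℕ} (hn : k + 1 = n) (hm : l + 1 = 2 * m) :
    numPerfectMatchings (kagomeCylinder n m) = 2 ^ ((k + 1) * l + 1) := by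
  rw [(isPatchQuotient_cylinder hn hm).numPerfectMatchings_eq,
    ← ncard_isEven_of_row (k := k) (l := l) ⟨m, by omega⟩]
  simp only [forall_vStars_iff hn hm]

theorem numPerfectMatchings_free {n m : ℕ} (hn : k + 1 = n) (hm : l + 1 = 2 * m) :
    numPerfectMatchings (kagomeFree n m) = 2 ^ (k * l) := by
  rw [(isPatchQuotient_free hn hm).numPerfectMatchings_eq,
    ← ncard_isEven_of_row_of_column (k := k) (l := l) ⟨m, by omega⟩]
  congr 1
  ext x
  simp only [Set.mem_ofPred_eq, ← forall_vStars_iff hn hm, ← forall_uStars_iff hn hm,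
    Set.mem_union, or_imp, forall_and, and_comm]

theorem exists_columns_rows {n m : ℕ} (hn : 1 ≤ n) (hm : 1 ≤ m) :
    ∃ k l, k + 1 = n ∧ l + 1 = 2 * m :=
  ⟨n - 1, 2 * m - 1, by omega, by omega⟩

/-- Exponents are integers so that the subtractions are genuine; `k * l` is `(n - 1)(2m - 1)`. -/
theorem numPerfectMatchings_kagome {n m : ℕ} (hn : 1 ≤ n) (hm : 1 ≤ m) :
    (numPerfectMatchings (kagomeTorus n m) : ℚ) = 2 ^ (2 * (m : ℤ) * n + 1) ∧
    (numPerfectMatchings (kagomeCylinder n m) : ℚ) = 2 ^ (2 * (m : ℤ) * n - n + 1) ∧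
    (numPerfectMatchings (kagomeFree n m) : ℚ) = 2 ^ (2 * (m : ℤ) * n - 2 * m - n + 1) := by
  obtain ⟨k, l, hn, hm⟩ := exists_columns_rows hn hm
  have hn' : (n : ℤ) = k + 1 := by omega
  have hm' : 2 * (m : ℤ) = l + 1 := by omega
  rw [numPerfectMatchings_torus hn hm, numPerfectMatchings_cylinder hn hm,
    numPerfectMatchings_free hn hm, hm', hn']
  refine ⟨?_, ?_, ?_⟩ <;> rw [Nat.cast_pow, Nat.cast_ofNat, ← zpow_natCast] <;> congr 1 <;>
    push_cast <;> ring

/-! ### The entropy limit -/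

theorem tendsto_two_mul_add_div (a b c : ℝ) :
    Tendsto (fun p : ℕ × ℕ => (2 * (p.2 : ℝ) * p.1 + a * p.2 + b * p.1 + c) / (3 * (p.1 * p.2)))
      (atTop ×ˢ atTop) (𝓝 (2 / 3)) := by
  have h1 : Tendsto (fun p : ℕ × ℕ => ((p.1 : ℝ))⁻¹) (atTop ×ˢ atTop) (𝓝 0) :=
    tendsto_inv_atTop_nhds_zero_nat.comp tendsto_fst
  have h2 : Tendsto (fun p : ℕ × ℕ => ((p.2 : ℝ))⁻¹) (atTop ×ˢ atTop) (𝓝 0) :=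
    tendsto_inv_atTop_nhds_zero_nat.comp tendsto_snd
  -- For nonzero `n`, `m` the quotient is `2/3 + (a/3)/n + (b/3)/m + (c/3)/(nm)`.
  have h := (((h1.const_mul (a / 3)).const_add (2 / 3)).add (h2.const_mul (b / 3))).add
    ((h1.mul h2).const_mul (c / 3))
  simp only [mul_zero, add_zero] at h
  refine h.congr' ?_
  filter_upwards [tendsto_fst.eventually (eventually_ge_atTop 1),
    tendsto_snd.eventually (eventually_ge_atTop 1)] with p hp hq
  have hp : (p.1 : ℝ) ≠ 0 := by positivity
  have hq : (p.2 : ℝ) ≠ 0 := by positivity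
  field_simp

/-- Only the leading term `2mn` of the exponent matters against the `6nm` vertices; the boundary
enters through `a`, `b`, `c`. -/
theorem hasEntropy_of_eq_zpow {G : ℕ → ℕ → Graph (ℤ × ℤ) (Sym2 (ℤ × ℤ))} (a b c : ℤ)
    (hM : ∀ n m : ℕ, 1 ≤ n → 1 ≤ m →
      (numPerfectMatchings (G n m) : ℚ) = 2 ^ (2 * (m : ℤ) * n + a * m + b * n + c))
    (hV : ∀ n m : ℕ, 1 ≤ n → 1 ≤ m → V(G n m).ncard = 6 * (n * m)) :
    HasEntropy G (2 / 3 * Real.log 2) := by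
  refine ((tendsto_two_mul_add_div a b c).mul_const (Real.log 2)).congr' ?_
  filter_upwards [tendsto_fst.eventually (eventually_ge_atTop 1),
    tendsto_snd.eventually (eventually_ge_atTop 1)] with p hp hq
  have h : (numPerfectMatchings (G p.1 p.2) : ℝ) =
      2 ^ (2 * (p.2 : ℤ) * p.1 + a * p.2 + b * p.1 + c) := by
    simpa using congrArg (Rat.cast : ℚ → ℝ) (hM p.1 p.2 hp hq)
  rw [h, hV p.1 p.2 hp hq, Real.log_zpow]
  have hp : (p.1 : ℝ) ≠ 0 := by positivity
  have hq : (p.2 : ℝ) ≠ 0 := by positivity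
  push_cast
  field_simp
  ring

end KagomeDimers

theorem theorem3p4 :
    (∀ n m : ℕ, 1 ≤ n → 1 ≤ m →
      (KagomeDimers.numPerfectMatchings (KagomeDimers.kagomeTorus n m) : ℚ) =
          2 ^ (2 * (m : ℤ) * n + 1) ∧
      (KagomeDimers.numPerfectMatchings (KagomeDimers.kagomeCylinder n m) : ℚ) =
          2 ^ (2 * (m : ℤ) * n - n + 1) ∧
      (KagomeDimers.numPerfectMatchings (KagomeDimers.kagomeFree n m) : ℚ) =
          2 ^ (2 * (m : ℤ) * n - 2 * m - n + 1)) ∧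
    KagomeDimers.HasEntropy KagomeDimers.kagomeTorus (2 / 3 * Real.log 2) ∧
    KagomeDimers.HasEntropy KagomeDimers.kagomeCylinder (2 / 3 * Real.log 2) ∧
    KagomeDimers.HasEntropy KagomeDimers.kagomeFree (2 / 3 * Real.log 2) := by
  refine ⟨fun n m hn hm => KagomeDimers.numPerfectMatchings_kagome hn hm,
    KagomeDimers.hasEntropy_of_eq_zpow 0 0 1 (fun n m hn hm => ?_) fun n m hn hm => ?_,
    KagomeDimers.hasEntropy_of_eq_zpow 0 (-1) 1 (fun n m hn hm => ?_) fun n m hn hm => ?_,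
    KagomeDimers.hasEntropy_of_eq_zpow (-2) (-1) 1 (fun n m hn hm => ?_) fun n m hn hm => ?_⟩
  · rw [(KagomeDimers.numPerfectMatchings_kagome hn hm).1]
    congr 1; ring
  · obtain ⟨k, l, hn, hm⟩ := KagomeDimers.exists_columns_rows hn hm
    exact (KagomeDimers.isPatchQuotient_torus hn hm).ncard_vertexSet
  · rw [(KagomeDimers.numPerfectMatchings_kagome hn hm).2.1]
    congr 1; ring
  · obtain ⟨k, l, hn, hm⟩ := KagomeDimers.exists_columns_rows hn hm
    exact (KagomeDimers.isPatchQuotient_cylinder hn hm).ncard_vertexSet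
  · rw [(KagomeDimers.numPerfectMatchings_kagome hn hm).2.2]
    congr 1; ring
  · obtain ⟨k, l, hn, hm⟩ := KagomeDimers.exists_columns_rows hn hm
    exact (KagomeDimers.isPatchQuotient_free hn hm).ncard_vertexSet
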